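/- Let $E_1(x)=\int_x^\infty \frac{e^{-u}}{u}\,du$ for $x>0$, and for $\nu\in\mathbb{C}$, $y>0$ let $$\mathcal{P}_{\nu,2}\{f(x);y\}=\int_0^\infty \frac{x\,f(x)}{(x^2+y^2)^{\nu}}\,dx .$$ For $\kappa,\mu\in\mathbb{C}$ let $W_{\kappa,\mu}$ denote Whittaker's function on $(0,\infty)$, that is, the unique solution of Whittaker's equation $$W''(x)+\Big(-\frac14+\frac{\kappa}{x}+\frac{\frac14-\mu^2}{x^2}\Big)W(x)=0\qquad(x>0)$$ with $W(x)\sim e^{-x/2}x^{\kappa}$ as $x\to\infty$. Let $a>0$, $y>0$ and $\nu\in\mathbb{C}$ with $\Re(\nu)>1$. Then the integral defining $\mathcal{P}_{\nu,2}\{E_1(a^2/x^2);y\}$ converges absolutely, and $$\mathcal{P}_{\nu,2}\Big\{E_1\Big(\frac{a^2}{x^2}\Big);y\Big\}=\frac{\Gamma(\nu-1)}{2a(\nu-1)}\,y^{-2\nu+3}\,\exp\Big(\frac{a^2}{2y^2}\Big)\,W_{-\nu+\frac32,\,0}\Big(\frac{a^2}{y^2}\Big).$$ -/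

import Mathlib

open Set Filter Topology MeasureTheory

noncomputable section

/-- The exponential integral `E₁(x) = ∫_x^∞ e^{-u} / u du`, for `x > 0`. -/
def expIntegralE1 (x : ℝ) : ℝ :=
  ∫ u in Ioi x, Real.exp (-u) / u

/-- The integrand `x f(x) / (x² + y²)^ν` of the `P_{ν,2}`-transform. -/
def potentialIntegrand (ν : ℂ) (f : ℝ → ℂ) (y x : ℝ) : ℂ :=
  (x : ℂ) * f x / ((x ^ 2 + y ^ 2 : ℝ) : ℂ) ^ ν

/-- The `P_{ν,2}`-transform `∫_0^∞ x f(x) / (x² + y²)^ν dx` of `f` at `y`. -/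
def potentialTransform (ν : ℂ) (f : ℝ → ℂ) (y : ℝ) : ℂ :=
  ∫ x in Ioi (0 : ℝ), potentialIntegrand ν f y x

/-- `W` is, on the positive half-line, a solution of Whittaker's differential equation
`W'' + (-1/4 + κ/x + (1/4 - μ²)/x²) W = 0` with `W(x) ~ e^{-x/2} x^κ` as `x → ∞`.
These two conditions determine `W` on the positive half-line: every solution that is not a
multiple of the recessive one grows like a multiple of `e^{x/2} x^{-κ}`. -/
structure IsWhittakerW (κ μ : ℂ) (W : ℝ → ℂ) : Prop where
  differentiableAt : ∀ x : ℝ, 0 < x → DifferentiableAt ℝ W x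
  differentiableAt_deriv : ∀ x : ℝ, 0 < x → DifferentiableAt ℝ (deriv W) x
  equation : ∀ x : ℝ, 0 < x →
    deriv (deriv W) x + (-1 / 4 + κ / (x : ℂ) + (1 / 4 - μ ^ 2) / (x : ℂ) ^ 2) * W x = 0
  asymptotic : Asymptotics.IsEquivalent atTop W
    (fun x : ℝ => Complex.exp (-(x : ℂ) / 2) * (x : ℂ) ^ κ)

/-- Whittaker's function `W_{κ,μ}(x)`, for complex `κ`, `μ` and `x > 0`: the unique solution of
Whittaker's equation on the positive half-line with `W_{κ,μ}(x) ~ e^{-x/2} x^κ` as `x → ∞`. -/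
def whittakerW (κ μ : ℂ) (x : ℝ) : ℂ :=
  Classical.epsilon (fun W : ℝ → ℂ => IsWhittakerW κ μ W) x

end

/-!
Integrating by parts, with `d/dx E₁(a²/x²) = (2/x) e^{-a²/x²}`, and substituting `s = y²/x²` turn
the potential transform of `E₁(a²/x²)` into the Laplace integral
`∫_0^∞ s^{α-1} (1+s)^{-α} e^{-zs} ds` with `α = ν - 1` and `z = a²/y²`
(`integral_expIntegralE1_mul_cpow`). Both the absolute convergence and the vanishing of the boundary
terms come from the single bound `0 ≤ E₁(z) ≤ z^{-δ}/δ` for `0 < δ ≤ 1`.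

The Laplace integral is `Γ(α) U(α, 1, z)`, so that `e^{-z/2} z^{1/2}` times it, divided by `Γ(α)`,
is a Whittaker function with `κ = 1/2 - α` and `μ = 0` (`isWhittakerW_laplaceIntegral`): the
equation follows by differentiating under the integral sign and integrating an exact derivative, and
the asymptotics from dominated convergence after rescaling.

Since `whittakerW` is picked out only by its characterization, uniqueness is needed as well
(`IsWhittakerW.eqOn`). Two solutions with the prescribed asymptotics tend to zero, hence so do their
derivatives, because the coefficient of the equation is bounded at infinity. Their Wronskian is
constant and tends to zero, so the solutions are proportional, and the asymptotics forces the
factor to be `1`.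
-/

/-! ### Second-order linear equations and uniqueness of Whittaker's function -/

/-- If `D'' = -q D` with `q` bounded near infinity and `D → 0`, then `D' → 0`: by the mean value
inequality `D'(x)` differs from `D(x + 1) - D(x)` by at most `sup |D''|` over `[x, x + 1]`. -/
theorem tendsto_deriv_zero_of_linear_ode {q D D' : ℝ → ℂ} {C : ℝ}
    (hq : ∀ x : ℝ, 1 ≤ x → ‖q x‖ ≤ C)
    (hD : ∀ x : ℝ, 0 < x → HasDerivAt D (D' x) x)
    (hD' : ∀ x : ℝ, 0 < x → HasDerivAt D' (-(q x * D x)) x)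
    (hlim : Tendsto D atTop (𝓝 0)) : Tendsto D' atTop (𝓝 0) := by
  have hC : 0 ≤ C := (norm_nonneg _).trans (hq 1 le_rfl)
  simp only [Metric.tendsto_atTop, dist_eq_norm] at hlim ⊢
  intro ε hε
  obtain ⟨N, hN⟩ := hlim (ε / (C + 3)) (by positivity)
  simp only [sub_zero] at hN ⊢
  refine ⟨max N 1, fun x hx => ?_⟩
  have hxN : N ≤ x := (le_max_left _ _).trans hx
  have hx1 : 1 ≤ x := (le_max_right _ _).trans hx
  set δ := ε / (C + 3) with hδ
  have hδ0 : 0 < δ := by positivity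
  have hD'' : ∀ t ∈ Icc x (x + 1), ‖D' t - D' x‖ ≤ C * δ := by
    intro t ht
    have := (convex_Icc x (x + 1)).norm_image_sub_le_of_norm_hasDerivWithin_le
      (f := D') (f' := fun t => -(q t * D t)) (C := C * δ) (x := x) (y := t)
      (fun s hs => (hD' s (by linarith [hs.1])).hasDerivWithinAt)
      (fun s hs => by
        rw [norm_neg, norm_mul]
        exact mul_le_mul (hq s (hx1.trans hs.1)) (hN s (hxN.trans hs.1)).le (norm_nonneg _) hC)
      (left_mem_Icc.2 (by linarith)) ht
    refine this.trans (mul_le_of_le_one_right (by positivity) ?_)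
    rw [Real.norm_eq_abs, abs_le]; constructor <;> linarith [ht.1, ht.2]
  have h := (convex_Icc x (x + 1)).norm_image_sub_le_of_norm_hasDerivWithin_le
    (f := fun t => D t - (t : ℂ) * D' x) (f' := fun t => D' t - D' x) (C := C * δ)
    (x := x) (y := x + 1)
    (fun s hs => by
      have := (hD s (by linarith [hs.1])).sub
        ((Complex.ofRealCLM.hasDerivAt (x := s)).mul_const (D' x))
      exact (this.congr_deriv (by simp)).hasDerivWithinAt)
    hD'' (left_mem_Icc.2 (by linarith)) (right_mem_Icc.2 (by linarith))
  have e : D' x = D (x + 1) - D x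
      - ((D (x + 1) - ((x + 1 : ℝ) : ℂ) * D' x) - (D x - (x : ℂ) * D' x)) := by
    push_cast; ring
  have h1 := hN x hxN
  have h2 := hN (x + 1) (by linarith)
  have h3 : ‖(x + 1 : ℝ) - x‖ = 1 := by simp
  rw [h3, mul_one] at h
  have h4 : (C + 3) * δ = ε := by rw [hδ]; field_simp
  calc ‖D' x‖ ≤ ‖D (x + 1)‖ + ‖D x‖ + C * δ := by
        rw [e]
        exact (norm_sub_le _ _).trans (add_le_add (norm_sub_le _ _) h)
    _ < ε := by nlinarith

/-- A solution of `D'' = -q D` on the positive half-line that vanishes to first order at a point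
vanishes identically. -/
theorem linear_ode_eq_zero {q D D' : ℝ → ℂ} (hq : ContinuousOn q (Ioi 0))
    (hD : ∀ x : ℝ, 0 < x → HasDerivAt D (D' x) x)
    (hD' : ∀ x : ℝ, 0 < x → HasDerivAt D' (-(q x * D x)) x)
    {x₀ : ℝ} (hx₀ : 0 < x₀) (h0 : D x₀ = 0) (h0' : D' x₀ = 0) {x : ℝ} (hx : 0 < x) :
    D x = 0 := by
  set a := min x x₀ / 2 with ha
  set b := max x x₀ + 1 with hb
  have hm : 0 < min x x₀ := lt_min hx hx₀
  have ha0 : 0 < a := by positivity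
  have hpos : ∀ t ∈ Icc a b, 0 < t := fun t ht => ha0.trans_le ht.1
  obtain ⟨C, hC⟩ := (isCompact_Icc (a := a) (b := b)).exists_bound_of_continuousOn
    (hq.mono hpos)
  have hax : a < x := by have := min_le_left x x₀; linarith
  have hax₀ : a < x₀ := by have := min_le_right x x₀; linarith
  have hxb : x < b := by have := le_max_left x x₀; linarith
  have hx₀b : x₀ < b := by have := le_max_right x x₀; linarith
  have key := ODE_solution_unique_of_mem_Icc (E := ℂ × ℂ) (K := Real.toNNReal (max 1 C))
    (v := fun t p => (p.2, -(q t * p.1))) (s := fun _ => univ)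
    (f := fun t => (D t, D' t)) (g := fun _ => 0) (a := a) (b := b) (t₀ := x₀)
    (fun t ht => by
      refine LipschitzWith.lipschitzOnWith (LipschitzWith.of_dist_le_mul fun p r => ?_)
      rw [Real.coe_toNNReal _ (le_max_of_le_left zero_le_one), dist_eq_norm, dist_eq_norm]
      have h1 : ‖p.1 - r.1‖ ≤ ‖p - r‖ := norm_fst_le (p - r)
      have h2 : ‖p.2 - r.2‖ ≤ ‖p - r‖ := norm_snd_le (p - r)
      rw [Prod.norm_def]
      refine max_le ?_ ?_
      · change ‖p.2 - r.2‖ ≤ _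
        nlinarith [le_max_left 1 C, norm_nonneg (p - r)]
      · change ‖-(q t * p.1) - -(q t * r.1)‖ ≤ _
        rw [show -(q t * p.1) - -(q t * r.1) = -(q t * (p.1 - r.1)) by ring, norm_neg, norm_mul]
        exact mul_le_mul ((hC t (Ioo_subset_Icc_self ht)).trans (le_max_right _ _)) h1
          (norm_nonneg _) (le_max_of_le_left zero_le_one))
    ⟨hax₀, hx₀b⟩
    (fun t ht => ((hD t (hpos t ht)).continuousAt.prodMk
      (hD' t (hpos t ht)).continuousAt).continuousWithinAt)
    (fun t ht => (hD t (ha0.trans ht.1)).prodMk (hD' t (ha0.trans ht.1)))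
    (fun _ _ => mem_univ _) continuousOn_const
    (fun t _ => (hasDerivAt_const t (0 : ℂ × ℂ)).congr_deriv (by ext <;> simp))
    (fun _ _ => mem_univ _) (by simp [h0, h0'])
  exact congrArg Prod.fst (key ⟨hax.le, hxb.le⟩)

/-- The coefficient of `W` in Whittaker's equation. -/
noncomputable def whittakerCoeff (κ μ : ℂ) (x : ℝ) : ℂ :=
  -1 / 4 + κ / (x : ℂ) + (1 / 4 - μ ^ 2) / (x : ℂ) ^ 2

theorem continuousOn_whittakerCoeff (κ μ : ℂ) : ContinuousOn (whittakerCoeff κ μ) (Ioi 0) := by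
  have h : ∀ x ∈ Ioi (0 : ℝ), (x : ℂ) ≠ 0 := fun x hx => Complex.ofReal_ne_zero.2 (ne_of_gt hx)
  unfold whittakerCoeff
  refine (continuousOn_const.add (continuousOn_const.div (by fun_prop) h)).add
    (continuousOn_const.div (by fun_prop) fun x hx => pow_ne_zero 2 (h x hx))

theorem norm_whittakerCoeff_le (κ μ : ℂ) {x : ℝ} (hx : 1 ≤ x) :
    ‖whittakerCoeff κ μ x‖ ≤ ‖(-1 / 4 : ℂ)‖ + ‖κ‖ + ‖1 / 4 - μ ^ 2‖ := by
  have hn : ‖(x : ℂ)‖ = x := by simp [abs_of_pos (zero_lt_one.trans_le hx)]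
  refine (norm_add₃_le).trans (add_le_add_three le_rfl ?_ ?_)
  · rw [norm_div, hn]; exact div_le_self (norm_nonneg _) hx
  · rw [norm_div, norm_pow, hn]; exact div_le_self (norm_nonneg _) (one_le_pow₀ hx)

theorem tendsto_exp_neg_half_mul_cpow (κ : ℂ) :
    Tendsto (fun x : ℝ => Complex.exp (-(x : ℂ) / 2) * (x : ℂ) ^ κ) atTop (𝓝 0) := by
  rw [tendsto_zero_iff_norm_tendsto_zero]
  refine (tendsto_rpow_mul_exp_neg_mul_atTop_nhds_zero κ.re (1 / 2) (by norm_num)).congr' ?_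
  filter_upwards [eventually_gt_atTop 0] with x hx
  rw [norm_mul, Complex.norm_cpow_eq_rpow_re_of_pos hx, Complex.norm_exp, mul_comm]
  congr 2
  simp; ring

namespace IsWhittakerW

variable {κ μ : ℂ} {W W₁ W₂ : ℝ → ℂ}

theorem hasDerivAt (h : IsWhittakerW κ μ W) (x : ℝ) (hx : 0 < x) :
    HasDerivAt W (deriv W x) x := (h.differentiableAt x hx).hasDerivAt

theorem hasDerivAt_deriv (h : IsWhittakerW κ μ W) (x : ℝ) (hx : 0 < x) :
    HasDerivAt (deriv W) (-(whittakerCoeff κ μ x * W x)) x := by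
  have h1 : deriv (deriv W) x = -(whittakerCoeff κ μ x * W x) :=
    eq_neg_of_add_eq_zero_left (h.equation x hx)
  exact (h.differentiableAt_deriv x hx).hasDerivAt.congr_deriv h1

theorem tendsto_zero (h : IsWhittakerW κ μ W) : Tendsto W atTop (𝓝 0) :=
  h.asymptotic.symm.tendsto_nhds (tendsto_exp_neg_half_mul_cpow κ)

theorem tendsto_deriv_zero (h : IsWhittakerW κ μ W) : Tendsto (deriv W) atTop (𝓝 0) :=
  tendsto_deriv_zero_of_linear_ode (fun _ => norm_whittakerCoeff_le κ μ) h.hasDerivAt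
    h.hasDerivAt_deriv h.tendsto_zero

/-- The Wronskian is constant by the equation, and tends to zero at infinity. -/
theorem wronskian_eq_zero (h₁ : IsWhittakerW κ μ W₁) (h₂ : IsWhittakerW κ μ W₂) {x : ℝ}
    (hx : 0 < x) : W₁ x * deriv W₂ x - deriv W₁ x * W₂ x = 0 := by
  have hd : ∀ t ∈ Ioi (0 : ℝ),
      HasDerivAt (fun t => W₁ t * deriv W₂ t - deriv W₁ t * W₂ t) 0 t := fun t ht => by
    refine (((h₁.hasDerivAt t ht).mul (h₂.hasDerivAt_deriv t ht)).sub
      ((h₁.hasDerivAt_deriv t ht).mul (h₂.hasDerivAt t ht))).congr_deriv ?_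
    ring
  have hconst : ∀ t ∈ Ioi (0 : ℝ), W₁ t * deriv W₂ t - deriv W₁ t * W₂ t =
      W₁ x * deriv W₂ x - deriv W₁ x * W₂ x := fun t ht =>
    isOpen_Ioi.is_const_of_deriv_eq_zero isPreconnected_Ioi
      (fun s hs => (hd s hs).differentiableAt.differentiableWithinAt)
      (fun s hs => (hd s hs).deriv) ht hx
  have hlim : Tendsto (fun t => W₁ t * deriv W₂ t - deriv W₁ t * W₂ t) atTop (𝓝 0) := by
    simpa using (h₁.tendsto_zero.mul h₂.tendsto_deriv_zero).sub
      (h₁.tendsto_deriv_zero.mul h₂.tendsto_zero)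
  refine tendsto_nhds_unique (tendsto_const_nhds.congr' ?_) hlim
  filter_upwards [eventually_gt_atTop 0] with t ht using (hconst t ht).symm

/-- The Whittaker function is unique on the positive half-line: as the Wronskian vanishes, two
candidates are proportional, and their common asymptotics makes the factor `1`. -/
theorem eqOn (h₁ : IsWhittakerW κ μ W₁) (h₂ : IsWhittakerW κ μ W₂) : EqOn W₁ W₂ (Ioi 0) := by
  have hne : ∀ᶠ x : ℝ in atTop, Complex.exp (-(x : ℂ) / 2) * (x : ℂ) ^ κ ≠ 0 := by
    filter_upwards [eventually_gt_atTop 0] with x hx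
    exact mul_ne_zero (Complex.exp_ne_zero _)
      (by rw [Complex.cpow_ne_zero_iff]; exact Or.inl (Complex.ofReal_ne_zero.2 hx.ne'))
  have hratio : Tendsto (W₁ / W₂) atTop (𝓝 1) := by
    have a₁ := (Asymptotics.isEquivalent_iff_tendsto_one hne).1 h₁.asymptotic
    have a₂ := (Asymptotics.isEquivalent_iff_tendsto_one hne).1 h₂.asymptotic
    have := a₁.div a₂ one_ne_zero
    rw [div_one] at this
    refine this.congr' ?_
    filter_upwards [hne] with x hx
    exact div_div_div_cancel_right₀ hx _ _
  have hne₂ : ∀ᶠ x : ℝ in atTop, W₂ x ≠ 0 := by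
    filter_upwards [hratio.eventually_ne one_ne_zero] with x hx h0
    exact hx (by simp [h0])
  obtain ⟨x₀, hx₀ne, hx₀⟩ := (hne₂.and (eventually_gt_atTop 0)).exists
  set c := W₁ x₀ / W₂ x₀ with hc
  have hw := wronskian_eq_zero h₁ h₂ hx₀
  have hprop : ∀ x : ℝ, 0 < x → W₁ x = c * W₂ x := fun x hx => by
    refine sub_eq_zero.1 (linear_ode_eq_zero (continuousOn_whittakerCoeff κ μ)
      (D := fun t => W₁ t - c * W₂ t) (D' := fun t => deriv W₁ t - c * deriv W₂ t)
      (fun t ht => (h₁.hasDerivAt t ht).sub ((h₂.hasDerivAt t ht).const_mul c))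
      (fun t ht => ?_) hx₀ ?_ ?_ hx)
    · refine ((h₁.hasDerivAt_deriv t ht).sub
        ((h₂.hasDerivAt_deriv t ht).const_mul c)).congr_deriv ?_
      ring
    · simp only [hc]; field_simp; ring
    · simp only [hc]; field_simp; linear_combination -hw
  have hc1 : c = 1 := by
    refine tendsto_nhds_unique (tendsto_const_nhds.congr' ?_) hratio
    filter_upwards [hne₂, eventually_gt_atTop 0] with x hx hx0
    rw [Pi.div_apply, hprop x hx0, mul_div_cancel_right₀ _ hx]
  intro x hx
  rw [hprop x hx, hc1, one_mul]

theorem whittakerW_eq (h : IsWhittakerW κ μ W) {x : ℝ} (hx : 0 < x) :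
    whittakerW κ μ x = W x :=
  eqOn (Classical.epsilon_spec (p := fun W : ℝ → ℂ => IsWhittakerW κ μ W) ⟨W, h⟩) h hx

end IsWhittakerW

/-! ### Laplace integrals and existence of Whittaker's function -/

theorem hasDerivAt_ofReal_comp_cpow_const {f : ℝ → ℝ} {f' x : ℝ} (hf : HasDerivAt f f' x)
    (hx : 0 < f x) (c : ℂ) :
    HasDerivAt (fun t : ℝ => (f t : ℂ) ^ c) (c * (f x : ℂ) ^ (c - 1) * f') x := by
  have h := ((hasDerivAt_id (f x : ℂ)).cpow_const (c := c)
    (Complex.ofReal_mem_slitPlane.2 hx)).scomp x hf.ofReal_comp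
  refine h.congr_deriv ?_
  simp only [id, smul_eq_mul]
  ring

/-- The Laplace transform `∫_0^∞ f(s) e^{-zs} ds`. -/
noncomputable def laplaceIntegral (f : ℝ → ℂ) (z : ℝ) : ℂ :=
  ∫ s in Ioi (0 : ℝ), f s * (Real.exp (-(z * s)) : ℂ)

theorem integrableOn_rpow_mul_exp_neg {β z : ℝ} (hβ : 0 < β) (hz : 0 < z) :
    IntegrableOn (fun s : ℝ => s ^ (β - 1) * Real.exp (-(z * s))) (Ioi 0) := by
  have := integrableOn_rpow_mul_exp_neg_mul_rpow (s := β - 1) (p := 1) (b := z) (by linarith)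
    one_pos hz
  simpa using this

section Laplace

variable {f : ℝ → ℂ} {β z : ℝ}

theorem norm_laplaceIntegrand_le (hb : ∀ s : ℝ, 0 < s → ‖f s‖ ≤ s ^ (β - 1)) {s : ℝ}
    (hs : 0 < s) :
    ‖f s * (Real.exp (-(z * s)) : ℂ)‖ ≤ s ^ (β - 1) * Real.exp (-(z * s)) := by
  rw [norm_mul, Complex.norm_real, Real.norm_of_nonneg (Real.exp_pos _).le]
  exact mul_le_mul_of_nonneg_right (hb s hs) (Real.exp_pos _).le

theorem aestronglyMeasurable_laplaceIntegrand (hf : ContinuousOn f (Ioi 0)) (z : ℝ) :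
    AEStronglyMeasurable (fun s : ℝ => f s * (Real.exp (-(z * s)) : ℂ))
      (volume.restrict (Ioi 0)) :=
  (hf.mul (by fun_prop)).aestronglyMeasurable measurableSet_Ioi

theorem integrableOn_laplaceIntegrand (hf : ContinuousOn f (Ioi 0)) (hβ : 0 < β)
    (hb : ∀ s : ℝ, 0 < s → ‖f s‖ ≤ s ^ (β - 1)) (hz : 0 < z) :
    IntegrableOn (fun s : ℝ => f s * (Real.exp (-(z * s)) : ℂ)) (Ioi 0) :=
  (integrableOn_rpow_mul_exp_neg hβ hz).mono' (aestronglyMeasurable_laplaceIntegrand hf z)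
    ((ae_restrict_iff' measurableSet_Ioi).2 (.of_forall fun _ hs => norm_laplaceIntegrand_le hb hs))

theorem norm_ofReal_mul_le_rpow (hb : ∀ s : ℝ, 0 < s → ‖f s‖ ≤ s ^ (β - 1)) {s : ℝ}
    (hs : 0 < s) : ‖(s : ℂ) * f s‖ ≤ s ^ ((β + 1) - 1) := by
  rw [norm_mul, Complex.norm_real, Real.norm_of_nonneg hs.le,
    show β + 1 - 1 = 1 + (β - 1) by ring, Real.rpow_add hs, Real.rpow_one]
  exact mul_le_mul_of_nonneg_left (hb s hs) hs.le

theorem hasDerivAt_laplaceIntegral (hf : ContinuousOn f (Ioi 0)) (hβ : 0 < β)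
    (hb : ∀ s : ℝ, 0 < s → ‖f s‖ ≤ s ^ (β - 1)) (hz : 0 < z) :
    HasDerivAt (laplaceIntegral f) (-laplaceIntegral (fun s => (s : ℂ) * f s) z) z := by
  have hf1 : ContinuousOn (fun s : ℝ => (s : ℂ) * f s) (Ioi 0) :=
    Complex.continuous_ofReal.continuousOn.mul hf
  have h := hasDerivAt_integral_of_dominated_loc_of_deriv_le (μ := volume.restrict (Ioi (0 : ℝ)))
    (F := fun z s => f s * (Real.exp (-(z * s)) : ℂ))
    (F' := fun z s => -((s : ℂ) * f s * (Real.exp (-(z * s)) : ℂ))) (x₀ := z)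
    (s := Ioi (z / 2))
    (bound := fun s => s ^ ((β + 1) - 1) * Real.exp (-(z / 2 * s)))
    (Ioi_mem_nhds (by linarith))
    (.of_forall fun w => aestronglyMeasurable_laplaceIntegrand hf w)
    (integrableOn_laplaceIntegrand hf hβ hb hz)
    (aestronglyMeasurable_laplaceIntegrand hf1 z).neg
    ((ae_restrict_iff' measurableSet_Ioi).2 (.of_forall fun s hs w hw => by
      rw [norm_neg]
      refine (norm_laplaceIntegrand_le (f := fun s => (s : ℂ) * f s)
        (fun s hs => norm_ofReal_mul_le_rpow hb hs) hs).trans ?_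
      have hs0 : 0 < s := hs
      gcongr
      exact le_of_lt hw))
    (integrableOn_rpow_mul_exp_neg (by linarith) (by linarith))
    ((ae_restrict_iff' measurableSet_Ioi).2 (.of_forall fun s hs w hw => by
      have h1 : HasDerivAt (fun w : ℝ => Real.exp (-(w * s))) (Real.exp (-(w * s)) * -s) w := by
        simpa using (((hasDerivAt_id w).mul_const s).neg).exp
      refine ((h1.ofReal_comp).const_mul (f s)).congr_deriv ?_
      push_cast; ring))
  have h2 := h.2
  rw [integral_neg] at h2
  exact h2

end Laplace

/-- The kernel `s^{α-1} (1+s)^{-α}`, whose Laplace transform is `Γ(α) U(α, 1, z)` for the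
confluent hypergeometric function `U`. -/
noncomputable def tricomiKernel (α : ℂ) (s : ℝ) : ℂ :=
  (s : ℂ) ^ (α - 1) * ((1 + s : ℝ) : ℂ) ^ (-α)

section Tricomi

variable {α : ℂ}

theorem continuousOn_tricomiKernel (α : ℂ) : ContinuousOn (tricomiKernel α) (Ioi 0) := by
  intro s hs
  have hs0 : 0 < s := hs
  have h1 : ContinuousAt (fun s : ℝ => (s : ℂ) ^ (α - 1)) s :=
    Complex.continuousAt_ofReal_cpow_const s _ (Or.inr hs0.ne')
  have h2 : ContinuousAt (fun s : ℝ => ((1 + s : ℝ) : ℂ) ^ (-α)) s :=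
    ContinuousAt.comp (g := fun t : ℝ => (t : ℂ) ^ (-α)) (f := fun s : ℝ => 1 + s)
      (Complex.continuousAt_ofReal_cpow_const (1 + s) _ (Or.inr (by positivity))) (by fun_prop)
  exact (h1.mul h2).continuousWithinAt

theorem norm_one_add_cpow_neg_le (hα : 0 ≤ α.re) {s : ℝ} (hs : 0 < s) :
    ‖((1 + s : ℝ) : ℂ) ^ (-α)‖ ≤ 1 := by
  rw [Complex.norm_cpow_eq_rpow_re_of_pos (by linarith)]
  exact Real.rpow_le_one_of_one_le_of_nonpos (by linarith) (by simpa using hα)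

theorem norm_tricomiKernel_le (hα : 0 < α.re) {s : ℝ} (hs : 0 < s) :
    ‖tricomiKernel α s‖ ≤ s ^ (α.re - 1) := by
  rw [tricomiKernel, norm_mul, Complex.norm_cpow_eq_rpow_re_of_pos hs]
  simpa using mul_le_of_le_one_right (Real.rpow_nonneg hs.le (α.re - 1))
    (norm_one_add_cpow_neg_le hα.le hs)

/-- Kummer's equation `z U'' + (1 - z) U' - α U = 0`, in terms of the moments of the kernel: the
integrand is minus the derivative of `s^α (1+s)^{1-α} e^{-zs}`. -/
theorem laplaceIntegral_tricomiKernel_recurrence (hα : 0 < α.re) {z : ℝ} (hz : 0 < z) :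
    z * laplaceIntegral (fun s => (s : ℂ) * ((s : ℂ) * tricomiKernel α s)) z
      - (1 - z) * laplaceIntegral (fun s => (s : ℂ) * tricomiKernel α s) z
      - α * laplaceIntegral (tricomiKernel α) z = 0 := by
  have c0 := continuousOn_tricomiKernel α
  have b0 := fun s hs => norm_tricomiKernel_le (α := α) hα (s := s) hs
  have c1 : ContinuousOn (fun s : ℝ => (s : ℂ) * tricomiKernel α s) (Ioi 0) :=
    Complex.continuous_ofReal.continuousOn.mul c0
  have b1 := fun s hs => norm_ofReal_mul_le_rpow b0 (s := s) hs
  have c2 : ContinuousOn (fun s : ℝ => (s : ℂ) * ((s : ℂ) * tricomiKernel α s)) (Ioi 0) :=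
    Complex.continuous_ofReal.continuousOn.mul c1
  have b2 := fun s hs => norm_ofReal_mul_le_rpow b1 (s := s) hs
  have i0 := integrableOn_laplaceIntegrand c0 hα b0 hz
  have i1 := integrableOn_laplaceIntegrand c1 (by linarith) b1 hz
  have i2 := integrableOn_laplaceIntegrand c2 (by linarith) b2 hz
  set G : ℝ → ℂ := fun s => (s : ℂ) ^ α * ((1 + s : ℝ) : ℂ) ^ (1 - α) *
    (Real.exp (-(z * s)) : ℂ) with hG
  have hα0 : α ≠ 0 := fun h => by simp [h] at hα
  have hGk : ∀ s : ℝ, 0 < s →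
      G s = (s : ℂ) * (1 + s) * (tricomiKernel α s * (Real.exp (-(z * s)) : ℂ)) := by
    intro s hs
    have hs0 : (s : ℂ) ≠ 0 := Complex.ofReal_ne_zero.2 hs.ne'
    have hs1 : ((1 + s : ℝ) : ℂ) ≠ 0 := Complex.ofReal_ne_zero.2 (by positivity)
    simp only [hG, tricomiKernel]
    rw [show (1 : ℂ) - α = -α + 1 by ring, Complex.cpow_add _ _ hs1, Complex.cpow_one,
      Complex.cpow_sub _ _ hs0, Complex.cpow_one]
    push_cast
    field_simp
  have hder : ∀ s ∈ Ioi (0 : ℝ), HasDerivAt G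
      (-(z * ((s : ℂ) * ((s : ℂ) * tricomiKernel α s) * (Real.exp (-(z * s)) : ℂ))
        - (1 - z) * ((s : ℂ) * tricomiKernel α s * (Real.exp (-(z * s)) : ℂ))
        - α * (tricomiKernel α s * (Real.exp (-(z * s)) : ℂ)))) s := by
    intro s hs
    have hs' : 0 < s := hs
    have hs0 : (s : ℂ) ≠ 0 := Complex.ofReal_ne_zero.2 hs'.ne'
    have hs1 : ((1 + s : ℝ) : ℂ) ≠ 0 := Complex.ofReal_ne_zero.2 (by positivity)
    have d1 : HasDerivAt (fun s : ℝ => (s : ℂ) ^ α) (α * (s : ℂ) ^ (α - 1)) s :=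
      hasDerivAt_ofReal_cpow_const hs'.ne' hα0
    have d2 : HasDerivAt (fun s : ℝ => ((1 + s : ℝ) : ℂ) ^ (1 - α))
        ((1 - α) * ((1 + s : ℝ) : ℂ) ^ (-α)) s := by
      refine (hasDerivAt_ofReal_comp_cpow_const (f := fun s => 1 + s)
        ((hasDerivAt_id s).const_add 1) (by positivity) (1 - α)).congr_deriv ?_
      rw [show (1 : ℂ) - α - 1 = -α by ring, Complex.ofReal_one, mul_one]
    have d3 : HasDerivAt (fun s : ℝ => (Real.exp (-(z * s)) : ℂ))
        ((Real.exp (-(z * s)) * -z : ℝ) : ℂ) s := by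
      have h1 : HasDerivAt (fun s : ℝ => Real.exp (-(z * s))) (Real.exp (-(z * s)) * -z) s := by
        simpa using (((hasDerivAt_id s).const_mul z).neg).exp
      exact h1.ofReal_comp
    refine ((d1.mul d2).mul d3).congr_deriv ?_
    simp only [tricomiKernel, Pi.mul_apply]
    rw [show (1 : ℂ) - α = -α + 1 by ring, Complex.cpow_add _ _ hs1, Complex.cpow_one,
      Complex.cpow_sub _ _ hs0, Complex.cpow_one]
    push_cast
    field_simp
    ring
  have hnorm : ∀ s : ℝ, 0 < s →
      ‖G s‖ ≤ s ^ α.re * Real.exp (-z * s) + s ^ (α.re + 1) * Real.exp (-z * s) := by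
    intro s hs
    rw [hGk s hs, norm_mul, norm_mul]
    have e1 : ‖(s : ℂ)‖ = s := by simp [abs_of_pos hs]
    have e2 : ‖(1 + s : ℂ)‖ = 1 + s := by
      rw [← Complex.ofReal_one, ← Complex.ofReal_add, Complex.norm_real,
        Real.norm_of_nonneg (by positivity)]
    rw [e1, e2]
    have h := norm_laplaceIntegrand_le (z := z) b0 hs
    refine (mul_le_mul_of_nonneg_left h (by positivity)).trans (le_of_eq ?_)
    rw [show α.re + 1 = (α.re - 1) + 1 + 1 by ring, Real.rpow_add_one hs.ne' (α.re - 1 + 1),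
      Real.rpow_add_one hs.ne', show s ^ α.re = s ^ (α.re - 1 + 1) by ring_nf,
      Real.rpow_add_one hs.ne', neg_mul]
    ring
  have hlim0 : Tendsto G (𝓝[>] 0) (𝓝 0) := by
    have h1 : ContinuousAt (fun s : ℝ => s ^ α.re * Real.exp (-z * s)
        + s ^ (α.re + 1) * Real.exp (-z * s)) 0 := by
      have a1 := Real.continuousAt_rpow_const 0 α.re (Or.inr hα.le)
      have a2 := Real.continuousAt_rpow_const 0 (α.re + 1) (Or.inr (by linarith))
      have a3 : ContinuousAt (fun s : ℝ => Real.exp (-z * s)) 0 := by fun_prop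
      exact (a1.mul a3).add (a2.mul a3)
    have h2 := h1.tendsto.mono_left (nhdsWithin_le_nhds (s := Ioi 0))
    simp only [Real.zero_rpow hα.ne', Real.zero_rpow (by linarith : α.re + 1 ≠ 0), zero_mul,
      add_zero] at h2
    refine squeeze_zero_norm' ?_ h2
    filter_upwards [self_mem_nhdsWithin] with s hs using hnorm s hs
  have hliminf : Tendsto G atTop (𝓝 0) := by
    have h2 := (tendsto_rpow_mul_exp_neg_mul_atTop_nhds_zero α.re z hz).add
      (tendsto_rpow_mul_exp_neg_mul_atTop_nhds_zero (α.re + 1) z hz)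
    rw [add_zero] at h2
    refine squeeze_zero_norm' ?_ h2
    filter_upwards [eventually_gt_atTop 0] with s hs using hnorm s hs
  have hint := ((i2.const_mul (z : ℂ)).sub (i1.const_mul (1 - z : ℂ))).sub (i0.const_mul α)
  have hG0 : G 0 = 0 := by simp [hG, hα0]
  have key := integral_Ioi_of_hasDerivAt_of_tendsto (a := 0) (f := G) (m := 0) ?_ hder hint.neg
    hliminf
  · rw [hG0, sub_zero, integral_neg, neg_eq_zero, integral_sub, integral_sub,
      integral_const_mul, integral_const_mul, integral_const_mul] at key
    · exact key
    · exact i2.const_mul _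
    · exact i1.const_mul _
    · exact (i2.const_mul (z : ℂ)).sub (i1.const_mul (1 - z : ℂ))
    · exact i0.const_mul _
  · rw [← continuousWithinAt_Ioi_iff_Ici]
    change Tendsto G (𝓝[>] 0) (𝓝 (G 0))
    rw [hG0]; exact hlim0

/-- Watson's lemma to leading order: `z^α ∫_0^∞ s^{α-1} (1+s)^{-α} e^{-zs} ds → Γ(α)`, by the
substitution `r = z s` and dominated convergence. -/
theorem tendsto_cpow_mul_laplaceIntegral_tricomiKernel (hα : 0 < α.re) :
    Tendsto (fun z : ℝ => (z : ℂ) ^ α * laplaceIntegral (tricomiKernel α) z) atTop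
      (𝓝 (Complex.Gamma α)) := by
  have hΓ : Complex.Gamma α =
      ∫ r in Ioi (0 : ℝ), (r : ℂ) ^ (α - 1) * (Real.exp (-(1 * r)) : ℂ) := by
    rw [Complex.Gamma_eq_integral hα, Complex.GammaIntegral]
    refine setIntegral_congr_fun measurableSet_Ioi fun r _ => ?_
    simp [mul_comm]
  have hscale : ∀ z : ℝ, 0 < z → (z : ℂ) ^ α * laplaceIntegral (tricomiKernel α) z =
      ∫ r in Ioi (0 : ℝ), (r : ℂ) ^ (α - 1) * ((1 + z⁻¹ * r : ℝ) : ℂ) ^ (-α) *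
        (Real.exp (-(1 * r)) : ℂ) := by
    intro z hz
    have hz0 : (z : ℂ) ≠ 0 := Complex.ofReal_ne_zero.2 hz.ne'
    have h := integral_comp_mul_left_Ioi (fun s : ℝ => tricomiKernel α s *
      (Real.exp (-(z * s)) : ℂ)) 0 (inv_pos.2 hz)
    rw [mul_zero, inv_inv] at h
    have h' : laplaceIntegral (tricomiKernel α) z = (z : ℂ)⁻¹ * ∫ r in Ioi (0 : ℝ),
        tricomiKernel α (z⁻¹ * r) * (Real.exp (-(z * (z⁻¹ * r))) : ℂ) := by
      rw [h, laplaceIntegral, Complex.real_smul, inv_mul_cancel_left₀ hz0]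
    rw [h', ← mul_assoc, ← integral_const_mul]
    refine setIntegral_congr_fun measurableSet_Ioi fun r hr => ?_
    have hr0 : 0 < r := hr
    simp only [tricomiKernel]
    rw [mul_inv_cancel_left₀ hz.ne', one_mul, Complex.ofReal_mul z⁻¹ r,
      Complex.mul_cpow_ofReal_nonneg (inv_pos.2 hz).le hr0.le, Complex.ofReal_inv,
      Complex.inv_cpow _ _ (by rw [Complex.arg_ofReal_of_nonneg hz.le]; exact Real.pi_pos.ne),
      Complex.cpow_sub _ _ hz0, Complex.cpow_one]
    have : (z : ℂ) ^ α ≠ 0 := by rw [Complex.cpow_ne_zero_iff]; exact Or.inl hz0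
    field_simp
  rw [hΓ]
  have hlim := tendsto_integral_filter_of_dominated_convergence
    (μ := volume.restrict (Ioi (0 : ℝ))) (l := atTop)
    (F := fun z r : ℝ => (r : ℂ) ^ (α - 1) * ((1 + z⁻¹ * r : ℝ) : ℂ) ^ (-α) *
        (Real.exp (-(1 * r)) : ℂ))
    (f := fun r : ℝ => (r : ℂ) ^ (α - 1) * (Real.exp (-(1 * r)) : ℂ))
    (fun r => r ^ (α.re - 1) * Real.exp (-(1 * r)))
    (by
      filter_upwards [eventually_gt_atTop 0] with z hz
      refine aestronglyMeasurable_laplaceIntegrand (fun s hs => ?_) 1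
      have hs0 : 0 < s := hs
      have h1 : ContinuousAt (fun s : ℝ => (s : ℂ) ^ (α - 1)) s :=
        Complex.continuousAt_ofReal_cpow_const s _ (Or.inr hs0.ne')
      have h2 : ContinuousAt (fun s : ℝ => ((1 + z⁻¹ * s : ℝ) : ℂ) ^ (-α)) s :=
        ContinuousAt.comp (g := fun t : ℝ => (t : ℂ) ^ (-α)) (f := fun s : ℝ => 1 + z⁻¹ * s)
          (Complex.continuousAt_ofReal_cpow_const _ _ (Or.inr (by positivity))) (by fun_prop)
      exact (h1.mul h2).continuousWithinAt)
    (by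
      filter_upwards [eventually_gt_atTop 0] with z hz
      refine (ae_restrict_iff' measurableSet_Ioi).2 (.of_forall fun r hr => ?_)
      refine norm_laplaceIntegrand_le
        (f := fun r : ℝ => (r : ℂ) ^ (α - 1) * ((1 + z⁻¹ * r : ℝ) : ℂ) ^ (-α))
        (fun s hs => ?_) hr
      rw [norm_mul, Complex.norm_cpow_eq_rpow_re_of_pos hs]
      simpa using mul_le_of_le_one_right (Real.rpow_nonneg hs.le (α.re - 1))
        (norm_one_add_cpow_neg_le hα.le (mul_pos (inv_pos.2 hz) hs)))
    (integrableOn_rpow_mul_exp_neg hα one_pos)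
    ((ae_restrict_iff' measurableSet_Ioi).2 (.of_forall fun r _ => by
      have h1 : Tendsto (fun z : ℝ => 1 + z⁻¹ * r) atTop (𝓝 1) := by
        simpa using (tendsto_inv_atTop_zero.mul_const r).const_add 1
      have h2 : Tendsto (fun z : ℝ => ((1 + z⁻¹ * r : ℝ) : ℂ) ^ (-α)) atTop (𝓝 1) := by
        have := (Complex.continuousAt_ofReal_cpow_const 1 (-α) (Or.inr one_ne_zero)).tendsto
        simp only [Complex.ofReal_one, Complex.one_cpow] at this
        exact this.comp h1
      simpa only [mul_one] using (h2.const_mul ((r : ℂ) ^ (α - 1))).mul_const (Real.exp (-(1 * r)) : ℂ)))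
  refine hlim.congr' ?_
  filter_upwards [eventually_gt_atTop 0] with z hz using (hscale z hz).symm

/-- The prefactor `e^{-x/2} x^{1/2}` that turns Kummer's equation into Whittaker's. -/
theorem hasDerivAt_exp_neg_half_mul_sqrt {x : ℝ} (hx : 0 < x) :
    HasDerivAt (fun x : ℝ => Complex.exp (-(x : ℂ) / 2) * (x : ℂ) ^ (1 / 2 : ℂ))
      ((-1 / 2 + 1 / (2 * (x : ℂ))) * (Complex.exp (-(x : ℂ) / 2) * (x : ℂ) ^ (1 / 2 : ℂ))) x := by
  have hx0 : (x : ℂ) ≠ 0 := Complex.ofReal_ne_zero.2 hx.ne'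
  have d1 : HasDerivAt (fun x : ℝ => Complex.exp (-(x : ℂ) / 2))
      (Complex.exp (-(x : ℂ) / 2) * (-1 / 2)) x := by
    have h : HasDerivAt (fun x : ℝ => -(x : ℂ) / 2) (-1 / 2) x :=
      (Complex.ofRealCLM.hasDerivAt (x := x)).neg.div_const 2 |>.congr_deriv (by simp)
    exact h.cexp
  have d2 : HasDerivAt (fun x : ℝ => (x : ℂ) ^ (1 / 2 : ℂ))
      ((1 / 2) * (x : ℂ) ^ ((1 / 2 : ℂ) - 1)) x :=
    hasDerivAt_ofReal_cpow_const hx.ne' (by norm_num)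
  refine (d1.mul d2).congr_deriv ?_
  rw [Complex.cpow_sub _ _ hx0, Complex.cpow_one]
  field_simp

/-- Existence of Whittaker's function with `μ = 0`, by the Laplace integral for
`W_{1/2-α,0}(x) = e^{-x/2} x^{1/2} U(α, 1, x)`. -/
theorem isWhittakerW_laplaceIntegral (hα : 0 < α.re) :
    IsWhittakerW (1 / 2 - α) 0 (fun x : ℝ => Complex.exp (-(x : ℂ) / 2) * (x : ℂ) ^ (1 / 2 : ℂ) *
      (laplaceIntegral (tricomiKernel α) x / Complex.Gamma α)) := by
  have c0 := continuousOn_tricomiKernel α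
  have b0 := fun s hs => norm_tricomiKernel_le (α := α) hα (s := s) hs
  have c1 : ContinuousOn (fun s : ℝ => (s : ℂ) * tricomiKernel α s) (Ioi 0) :=
    Complex.continuous_ofReal.continuousOn.mul c0
  have b1 := fun s hs => norm_ofReal_mul_le_rpow b0 (s := s) hs
  have hΓ : Complex.Gamma α ≠ 0 := Complex.Gamma_ne_zero_of_re_pos hα
  set g : ℝ → ℂ := fun x => Complex.exp (-(x : ℂ) / 2) * (x : ℂ) ^ (1 / 2 : ℂ) with hg
  set U : ℝ → ℂ := laplaceIntegral (tricomiKernel α) with hU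
  set V : ℝ → ℂ := laplaceIntegral (fun s => (s : ℂ) * tricomiKernel α s) with hV
  set Y : ℝ → ℂ := laplaceIntegral (fun s => (s : ℂ) * ((s : ℂ) * tricomiKernel α s)) with hY
  set W : ℝ → ℂ := fun x => g x * (U x / Complex.Gamma α) with hW
  have dg : ∀ x : ℝ, 0 < x → HasDerivAt g ((-1 / 2 + 1 / (2 * (x : ℂ))) * g x) x :=
    fun x hx => hasDerivAt_exp_neg_half_mul_sqrt hx
  have dU : ∀ x : ℝ, 0 < x → HasDerivAt U (-V x) x :=
    fun x hx => hasDerivAt_laplaceIntegral c0 hα b0 hx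
  have dV : ∀ x : ℝ, 0 < x → HasDerivAt V (-Y x) x :=
    fun x hx => hasDerivAt_laplaceIntegral c1 (by linarith) b1 hx
  have dW : ∀ x : ℝ, 0 < x → HasDerivAt W
      (g x * (((-1 / 2 + 1 / (2 * (x : ℂ))) * U x - V x) / Complex.Gamma α)) x := fun x hx => by
    refine ((dg x hx).mul ((dU x hx).div_const (Complex.Gamma α))).congr_deriv ?_
    ring
  have hW' : ∀ x : ℝ, 0 < x → deriv W =ᶠ[𝓝 x] fun x =>
      g x * (((-1 / 2 + 1 / (2 * (x : ℂ))) * U x - V x) / Complex.Gamma α) := fun x hx => by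
    filter_upwards [Ioi_mem_nhds hx] with t ht using (dW t ht).deriv
  have dW' : ∀ x : ℝ, 0 < x → HasDerivAt (deriv W)
      (g x * (((-1 / 2 + 1 / (2 * (x : ℂ))) ^ 2 * U x - 1 / (2 * (x : ℂ) ^ 2) * U x
        - 2 * (-1 / 2 + 1 / (2 * (x : ℂ))) * V x + Y x) / Complex.Gamma α)) x := fun x hx => by
    have hx0 : (x : ℂ) ≠ 0 := Complex.ofReal_ne_zero.2 hx.ne'
    refine HasDerivAt.congr_of_eventuallyEq ?_ (hW' x hx)
    have dr : HasDerivAt (fun x : ℝ => -1 / 2 + 1 / (2 * (x : ℂ))) (-(1 / (2 * (x : ℂ) ^ 2))) x := by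
      have h1 : HasDerivAt (fun x : ℝ => 2 * (x : ℂ)) 2 x :=
        ((Complex.ofRealCLM.hasDerivAt (x := x)).const_mul 2).congr_deriv (by simp)
      have h2 := ((h1.inv (mul_ne_zero two_ne_zero hx0)).const_add (-1 / 2 : ℂ))
      simp only [one_div]
      refine h2.congr_deriv ?_
      field_simp
    refine ((dg x hx).mul
      ((((dr.mul (dU x hx)).sub (dV x hx))).div_const (Complex.Gamma α))).congr_deriv ?_
    simp only [Pi.mul_apply, Pi.sub_apply]
    ring
  refine ⟨fun x hx => (dW x hx).differentiableAt, fun x hx => (dW' x hx).differentiableAt,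
    fun x hx => ?_, ?_⟩
  · have hx0 : (x : ℂ) ≠ 0 := Complex.ofReal_ne_zero.2 hx.ne'
    rw [(dW' x hx).deriv]
    have hrec := laplaceIntegral_tricomiKernel_recurrence hα hx
    change x * Y x - (1 - x) * V x - α * U x = 0 at hrec
    change _ + _ * (g x * (U x / Complex.Gamma α)) = 0
    field_simp
    linear_combination (16 : ℂ) * g x * x * hrec
  · rw [Asymptotics.isEquivalent_iff_tendsto_one]
    · have h := (tendsto_cpow_mul_laplaceIntegral_tricomiKernel hα).div_const (Complex.Gamma α)
      rw [div_self hΓ] at h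
      refine h.congr' ?_
      filter_upwards [eventually_gt_atTop 0] with x hx
      have hx0 : (x : ℂ) ≠ 0 := Complex.ofReal_ne_zero.2 hx.ne'
      have h1 : (x : ℂ) ^ α ≠ 0 := by rw [Complex.cpow_ne_zero_iff]; exact Or.inl hx0
      have h2 : (x : ℂ) ^ (1 / 2 : ℂ) ≠ 0 := by
        rw [Complex.cpow_ne_zero_iff]; exact Or.inl hx0
      have h3 := Complex.exp_ne_zero (-(x : ℂ) / 2)
      simp only [Pi.div_apply, hW, hg, hU]
      rw [Complex.cpow_sub _ _ hx0]
      field_simp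
    · filter_upwards [eventually_gt_atTop 0] with x hx
      exact mul_ne_zero (Complex.exp_ne_zero _)
        (by rw [Complex.cpow_ne_zero_iff]; exact Or.inl (Complex.ofReal_ne_zero.2 hx.ne'))

end Tricomi

/-! ### The exponential integral -/

section ExpIntegral

variable {z δ : ℝ}

theorem exp_neg_div_le_rpow {u : ℝ} (hu : 0 < u) (hδ : 0 ≤ δ) (hδ1 : δ ≤ 1) :
    Real.exp (-u) / u ≤ u ^ (-δ - 1) := by
  have h1 : u ^ δ ≤ Real.exp u := by
    have h2 : u ^ δ ≤ (1 + u) ^ δ := Real.rpow_le_rpow hu.le (by linarith) hδ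
    have h3 : (1 + u) ^ δ ≤ (1 + u) ^ (1 : ℝ) :=
      Real.rpow_le_rpow_of_exponent_le (by linarith) hδ1
    rw [Real.rpow_one] at h3
    linarith [Real.add_one_le_exp u]
  rw [Real.rpow_sub_one hu.ne', Real.exp_neg, Real.rpow_neg hu.le]
  gcongr

theorem integrableOn_exp_neg_div (hz : 0 < z) :
    IntegrableOn (fun u : ℝ => Real.exp (-u) / u) (Ioi z) := by
  refine (integrableOn_Ioi_rpow_of_lt (a := -1 - 1) (by norm_num) hz).mono' ?_ ?_
  · refine ContinuousOn.aestronglyMeasurable (fun u hu => ?_) measurableSet_Ioi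
    have hu0 : u ≠ 0 := (hz.trans hu).ne'
    exact ContinuousAt.continuousWithinAt (by fun_prop (disch := exact hu0))
  · refine (ae_restrict_iff' measurableSet_Ioi).2 (.of_forall fun u hu => ?_)
    have hu0 : 0 < u := hz.trans hu
    rw [Real.norm_of_nonneg (by positivity)]
    exact exp_neg_div_le_rpow hu0 zero_le_one le_rfl

theorem expIntegralE1_nonneg (hz : 0 < z) : 0 ≤ expIntegralE1 z :=
  setIntegral_nonneg measurableSet_Ioi fun _ hu =>
    div_nonneg (Real.exp_pos _).le (hz.trans hu).le

/-- A single power bound for `E₁`, which serves both its decay at infinity and its logarithmic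
singularity at `0`. -/
theorem expIntegralE1_le (hz : 0 < z) (hδ : 0 < δ) (hδ1 : δ ≤ 1) :
    expIntegralE1 z ≤ z ^ (-δ) / δ := by
  calc expIntegralE1 z ≤ ∫ u in Ioi z, u ^ (-δ - 1) :=
        setIntegral_mono_on (integrableOn_exp_neg_div hz)
          (integrableOn_Ioi_rpow_of_lt (by linarith) hz) measurableSet_Ioi
          fun u hu => exp_neg_div_le_rpow (hz.trans hu) hδ.le hδ1
    _ = z ^ (-δ) / δ := by
        rw [integral_Ioi_rpow_of_lt (by linarith) hz, sub_add_cancel, neg_div_neg_eq]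

theorem hasDerivAt_expIntegralE1 (hz : 0 < z) :
    HasDerivAt expIntegralE1 (-(Real.exp (-z) / z)) z := by
  have hz2 : 0 < z / 2 := by linarith
  have hcont : ∀ u : ℝ, 0 < u → ContinuousAt (fun u : ℝ => Real.exp (-u) / u) u := by
    intro u hu
    have hu0 := hu.ne'
    fun_prop (disch := exact hu0)
  have hcon : ContinuousOn (fun u : ℝ => Real.exp (-u) / u) (Ioi 0) :=
    fun u hu => (hcont u hu).continuousWithinAt
  have hint : IntervalIntegrable (fun u : ℝ => Real.exp (-u) / u) volume (z / 2) z :=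
    (hcon.mono fun u hu => by
      rw [uIcc_of_le (by linarith)] at hu
      exact hz2.trans_le hu.1).intervalIntegrable
  have h := (intervalIntegral.integral_hasDerivAt_right hint
    (hcon.stronglyMeasurableAtFilter isOpen_Ioi z hz) (hcont z hz)).const_sub
    (expIntegralE1 (z / 2))
  refine h.congr_of_eventuallyEq ?_
  filter_upwards [Ioi_mem_nhds (show z / 2 < z by linarith)] with w hw
  rw [eq_sub_iff_add_eq, add_comm]
  exact intervalIntegral.integral_interval_add_Ioi (integrableOn_exp_neg_div hz2)
    (integrableOn_exp_neg_div (hz2.trans hw))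

theorem hasDerivAt_expIntegralE1_div_sq {a x : ℝ} (ha : 0 < a) (hx : 0 < x) :
    HasDerivAt (fun x : ℝ => expIntegralE1 (a ^ 2 / x ^ 2))
      (2 / x * Real.exp (-(a ^ 2 / x ^ 2))) x := by
  have hz : 0 < a ^ 2 / x ^ 2 := by positivity
  have h1 : HasDerivAt (fun x : ℝ => a ^ 2 / x ^ 2) (-(2 * a ^ 2 / x ^ 3)) x := by
    have := (hasDerivAt_const x (a ^ 2)).div (hasDerivAt_pow 2 x) (pow_ne_zero 2 hx.ne')
    refine this.congr_deriv ?_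
    push_cast
    field_simp
    ring
  refine ((hasDerivAt_expIntegralE1 hz).comp x h1).congr_deriv ?_
  field_simp

theorem expIntegralE1_div_sq_le {a x : ℝ} (ha : 0 < a) (hx : 0 < x) (hδ : 0 < δ) (hδ1 : δ ≤ 1) :
    expIntegralE1 (a ^ 2 / x ^ 2) ≤ (a ^ 2) ^ (-δ) / δ * x ^ (2 * δ) := by
  refine (expIntegralE1_le (by positivity) hδ hδ1).trans (le_of_eq ?_)
  rw [Real.div_rpow (by positivity) (by positivity), Real.rpow_neg (sq_nonneg x),
    ← Real.rpow_natCast x 2, ← Real.rpow_mul hx.le]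
  push_cast
  rw [div_inv_eq_mul]
  ring

end ExpIntegral

/-! ### The potential transform of the exponential integral -/

section Transform

variable {α : ℂ} {a y x : ℝ}

theorem norm_sq_add_sq_cpow_neg_le_left (hα : 0 ≤ α.re) (hx : 0 < x) :
    ‖((x ^ 2 + y ^ 2 : ℝ) : ℂ) ^ (-α)‖ ≤ x ^ (-2 * α.re) := by
  rw [Complex.norm_cpow_eq_rpow_re_of_pos (by positivity), Complex.neg_re]
  refine (Real.rpow_le_rpow_of_nonpos (by positivity : 0 < x ^ 2)
    (by nlinarith [sq_nonneg y]) (by linarith)).trans (le_of_eq ?_)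
  rw [← Real.rpow_natCast x 2, ← Real.rpow_mul hx.le]
  push_cast
  ring_nf

theorem norm_sq_add_sq_cpow_neg_le_right (hα : 0 ≤ α.re) (hy : 0 < y) :
    ‖((x ^ 2 + y ^ 2 : ℝ) : ℂ) ^ (-α)‖ ≤ y ^ (-2 * α.re) := by
  rw [add_comm]
  exact norm_sq_add_sq_cpow_neg_le_left hα hy

theorem hasDerivAt_sq_add_sq_cpow (hα : α ≠ 0) (hy : 0 < y) (x : ℝ) :
    HasDerivAt (fun x : ℝ => ((x ^ 2 + y ^ 2 : ℝ) : ℂ) ^ (-α) / (-2 * α))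
      ((x : ℂ) * ((x ^ 2 + y ^ 2 : ℝ) : ℂ) ^ (-(α + 1))) x := by
  have h1 : HasDerivAt (fun x : ℝ => x ^ 2 + y ^ 2) (2 * x) x := by
    simpa using (hasDerivAt_pow 2 x).add_const (y ^ 2)
  have h2 := hasDerivAt_ofReal_comp_cpow_const h1 (by positivity) (-α)
  refine (h2.div_const (-2 * α)).congr_deriv ?_
  rw [show -(α + 1) = -α - 1 by ring]
  push_cast
  field_simp

/-- The substitution `s = y² / x²` at the level of integrands. -/
theorem tricomiKernel_substitution (α : ℂ) (ha : 0 < a) (hy : 0 < y) (hx : 0 < x) :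
    ((2 / x * Real.exp (-(a ^ 2 / x ^ 2)) : ℝ) : ℂ) * ((x ^ 2 + y ^ 2 : ℝ) : ℂ) ^ (-α) =
      ((y ^ 2 : ℝ) : ℂ) ^ (1 - α) * ((|(-2 : ℝ)| * x ^ ((-2 : ℝ) - 1)) •
        (tricomiKernel α (y ^ 2 * x ^ (-2 : ℝ)) *
          (Real.exp (-(a ^ 2 / y ^ 2 * (y ^ 2 * x ^ (-2 : ℝ)))) : ℂ))) := by
  have hx2 : x ^ (-2 : ℝ) = (x ^ 2)⁻¹ := by
    rw [Real.rpow_neg hx.le]; norm_cast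
  have hx3 : x ^ ((-2 : ℝ) - 1) = (x ^ 2)⁻¹ / x := by
    rw [Real.rpow_sub_one hx.ne', hx2]
  have e1 : a ^ 2 / y ^ 2 * (y ^ 2 * (x ^ 2)⁻¹) = a ^ 2 / x ^ 2 := by field_simp
  have hX : (0 : ℝ) < x ^ 2 := by positivity
  have hY : (0 : ℝ) < y ^ 2 := by positivity
  have hX0 : ((x ^ 2 : ℝ) : ℂ) ≠ 0 := Complex.ofReal_ne_zero.2 hX.ne'
  have hY0 : ((y ^ 2 : ℝ) : ℂ) ≠ 0 := Complex.ofReal_ne_zero.2 hY.ne'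
  have hinv : ∀ c : ℂ, (((x ^ 2)⁻¹ : ℝ) : ℂ) ^ c = (((x ^ 2 : ℝ) : ℂ) ^ c)⁻¹ := fun c => by
    rw [Complex.ofReal_inv, Complex.inv_cpow _ _
      (by rw [Complex.arg_ofReal_of_nonneg hX.le]; exact Real.pi_pos.ne)]
  have e2 : ((1 + y ^ 2 * (x ^ 2)⁻¹ : ℝ) : ℂ) ^ (-α) =
      ((x ^ 2 + y ^ 2 : ℝ) : ℂ) ^ (-α) * ((x ^ 2 : ℝ) : ℂ) ^ α := by
    rw [show (1 + y ^ 2 * (x ^ 2)⁻¹ : ℝ) = (x ^ 2 + y ^ 2) * (x ^ 2)⁻¹ by field_simp,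
      Complex.ofReal_mul, Complex.mul_cpow_ofReal_nonneg (by positivity) (by positivity), hinv,
      Complex.cpow_neg _ α, Complex.cpow_neg _ α, inv_inv]
  have e3 : ((y ^ 2 * (x ^ 2)⁻¹ : ℝ) : ℂ) ^ (α - 1) =
      ((y ^ 2 : ℝ) : ℂ) ^ (α - 1) * (((x ^ 2 : ℝ) : ℂ) ^ (α - 1))⁻¹ := by
    rw [Complex.ofReal_mul, Complex.mul_cpow_ofReal_nonneg (by positivity) (by positivity), hinv]
  rw [tricomiKernel, hx2, hx3, e1, e2, e3, Complex.cpow_sub _ _ hX0, Complex.cpow_sub _ _ hY0,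
    Complex.cpow_sub _ _ hY0, Complex.cpow_one, Complex.cpow_one, Complex.real_smul]
  have h1 : ((x ^ 2 : ℝ) : ℂ) ^ α ≠ 0 := by rw [Complex.cpow_ne_zero_iff]; exact Or.inl hX0
  have h2 : ((y ^ 2 : ℝ) : ℂ) ^ α ≠ 0 := by rw [Complex.cpow_ne_zero_iff]; exact Or.inl hY0
  have hx0 : (x : ℂ) ≠ 0 := Complex.ofReal_ne_zero.2 hx.ne'
  have hy0 : (y : ℂ) ≠ 0 := Complex.ofReal_ne_zero.2 hy.ne'
  rw [abs_neg, abs_two]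
  generalize ((x ^ 2 + y ^ 2 : ℝ) : ℂ) ^ (-α) = A at *
  generalize ((x ^ 2 : ℝ) : ℂ) ^ α = B at *
  generalize ((y ^ 2 : ℝ) : ℂ) ^ α = C at *
  generalize Real.exp (-(a ^ 2 / x ^ 2)) = D at *
  push_cast
  field_simp

theorem integrableOn_and_integral_inv_mul_exp_mul_cpow (hα : 0 < α.re) (ha : 0 < a)
    (hy : 0 < y) :
    IntegrableOn (fun x : ℝ => ((2 / x * Real.exp (-(a ^ 2 / x ^ 2)) : ℝ) : ℂ) *
        ((x ^ 2 + y ^ 2 : ℝ) : ℂ) ^ (-α)) (Ioi 0) ∧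
      ∫ x in Ioi (0 : ℝ), ((2 / x * Real.exp (-(a ^ 2 / x ^ 2)) : ℝ) : ℂ) *
        ((x ^ 2 + y ^ 2 : ℝ) : ℂ) ^ (-α) =
        ((y ^ 2 : ℝ) : ℂ) ^ (-α) * laplaceIntegral (tricomiKernel α) (a ^ 2 / y ^ 2) := by
  have hY : (0 : ℝ) < y ^ 2 := by positivity
  have hY0 : ((y ^ 2 : ℝ) : ℂ) ≠ 0 := Complex.ofReal_ne_zero.2 hY.ne'
  set h : ℝ → ℂ := fun s => tricomiKernel α s * (Real.exp (-(a ^ 2 / y ^ 2 * s)) : ℂ) with hh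
  have hi : IntegrableOn h (Ioi 0) :=
    integrableOn_laplaceIntegrand (continuousOn_tricomiKernel α) hα
      (fun s hs => norm_tricomiKernel_le hα hs) (by positivity)
  have hi' : IntegrableOn (fun s => h (y ^ 2 * s)) (Ioi 0) := by
    rw [integrableOn_Ioi_comp_mul_left_iff h 0 hY, mul_zero]
    exact hi
  have hi'' := (integrableOn_Ioi_comp_rpow_iff (fun s => h (y ^ 2 * s)) (p := -2)
    (by norm_num)).2 hi'
  constructor
  · refine (integrableOn_congr_fun (fun x hx => ?_) measurableSet_Ioi).2
      (hi''.const_mul (((y ^ 2 : ℝ) : ℂ) ^ (1 - α)))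
    exact tricomiKernel_substitution α ha hy hx
  · rw [setIntegral_congr_fun measurableSet_Ioi fun x hx =>
      tricomiKernel_substitution α ha hy hx, integral_const_mul,
      integral_comp_rpow_Ioi (fun s => h (y ^ 2 * s)) (p := -2) (by norm_num),
      integral_comp_mul_left_Ioi h 0 hY, mul_zero, Complex.real_smul, ← mul_assoc]
    congr 1
    rw [show (1 : ℂ) - α = -α + 1 by ring, Complex.cpow_add _ _ hY0, Complex.cpow_one,
      Complex.ofReal_inv, mul_inv_cancel_right₀ hY0]

theorem integrableOn_potentialIntegrand_expIntegralE1 (hα : 0 < α.re) (ha : 0 < a)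
    (hy : 0 < y) :
    IntegrableOn (fun x : ℝ => (expIntegralE1 (a ^ 2 / x ^ 2) : ℂ) *
      ((x : ℂ) * ((x ^ 2 + y ^ 2 : ℝ) : ℂ) ^ (-(α + 1)))) (Ioi 0) := by
  -- Any `0 < δ ≤ 1` with `δ < Re α` gives the exponent `1 + 2δ - 2 Re (α + 1) < -1` at infinity.
  set δ := min 1 (α.re / 2) with hδ
  have hδ0 : 0 < δ := lt_min one_pos (by linarith)
  have hδ1 : δ ≤ 1 := min_le_left _ _
  have hδα : 2 * δ ≤ α.re := by linarith [min_le_right 1 (α.re / 2)]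
  set C := (a ^ 2) ^ (-δ) / δ with hC
  have hC0 : 0 ≤ C := by positivity
  have hre : (0 : ℝ) ≤ (α + 1).re := by simp; linarith
  have hcont : ContinuousOn (fun x : ℝ => (expIntegralE1 (a ^ 2 / x ^ 2) : ℂ) *
      ((x : ℂ) * ((x ^ 2 + y ^ 2 : ℝ) : ℂ) ^ (-(α + 1)))) (Ioi 0) := by
    intro x hx
    have h1 := (hasDerivAt_expIntegralE1_div_sq ha hx).ofReal_comp.continuousAt
    have h2 : ContinuousAt (fun x : ℝ => ((x ^ 2 + y ^ 2 : ℝ) : ℂ) ^ (-(α + 1))) x :=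
      ContinuousAt.comp (g := fun t : ℝ => (t : ℂ) ^ (-(α + 1))) (f := fun x : ℝ => x ^ 2 + y ^ 2)
        (Complex.continuousAt_ofReal_cpow_const _ _ (Or.inr (by positivity))) (by fun_prop)
    exact (h1.mul (Complex.continuous_ofReal.continuousAt.mul h2)).continuousWithinAt
  have hnorm : ∀ x : ℝ, 0 < x → ∀ B : ℝ, ‖((x ^ 2 + y ^ 2 : ℝ) : ℂ) ^ (-(α + 1))‖ ≤ B →
      ‖(expIntegralE1 (a ^ 2 / x ^ 2) : ℂ) *
        ((x : ℂ) * ((x ^ 2 + y ^ 2 : ℝ) : ℂ) ^ (-(α + 1)))‖ ≤ C * x ^ (2 * δ) * (x * B) := by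
    intro x hx B hB
    rw [norm_mul, norm_mul, Complex.norm_real, Complex.norm_real, Real.norm_of_nonneg hx.le,
      Real.norm_of_nonneg (expIntegralE1_nonneg (by positivity))]
    have := expIntegralE1_div_sq_le ha hx hδ0 hδ1
    gcongr
  rw [← Ioc_union_Ioi_eq_Ioi zero_le_one]
  refine IntegrableOn.union ?_ ?_
  · refine (integrableOn_const (C := C * y ^ (-2 * (α + 1).re)) (by simp)).mono'
      ((hcont.mono Ioc_subset_Ioi_self).aestronglyMeasurable measurableSet_Ioc)
      ((ae_restrict_iff' measurableSet_Ioc).2 (.of_forall fun x hx => ?_))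
    refine (hnorm x hx.1 _ (norm_sq_add_sq_cpow_neg_le_right hre hy)).trans ?_
    have h1 : x ^ (2 * δ) ≤ 1 := Real.rpow_le_one hx.1.le hx.2 (by linarith)
    have h2 : 0 ≤ y ^ (-2 * (α + 1).re) := by positivity
    exact mul_le_mul (mul_le_of_le_one_right hC0 h1) (mul_le_of_le_one_left h2 hx.2)
      (mul_nonneg hx.1.le h2) hC0
  · have hexp : 2 * δ + 1 + -2 * (α + 1).re < -1 := by
      simp only [Complex.add_re, Complex.one_re]; linarith
    refine ((integrableOn_Ioi_rpow_of_lt hexp one_pos).const_mul C).mono'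
      ((hcont.mono (Ioi_subset_Ioi zero_le_one)).aestronglyMeasurable measurableSet_Ioi)
      ((ae_restrict_iff' measurableSet_Ioi).2 (.of_forall fun x hx => ?_))
    have hx0 : 0 < x := zero_lt_one.trans hx
    refine (hnorm x hx0 _ (norm_sq_add_sq_cpow_neg_le_left hre hx0)).trans (le_of_eq ?_)
    rw [Real.rpow_add hx0, Real.rpow_add_one hx0.ne']
    ring

/-- Integration by parts and the substitution `s = y² / x²` reduce the transform of `E₁` to the
Laplace integral representing Whittaker's function. -/
theorem integral_expIntegralE1_mul_cpow (hα : 0 < α.re) (ha : 0 < a) (hy : 0 < y) :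
    ∫ x in Ioi (0 : ℝ), (expIntegralE1 (a ^ 2 / x ^ 2) : ℂ) *
      ((x : ℂ) * ((x ^ 2 + y ^ 2 : ℝ) : ℂ) ^ (-(α + 1))) =
      ((y ^ 2 : ℝ) : ℂ) ^ (-α) * laplaceIntegral (tricomiKernel α) (a ^ 2 / y ^ 2) / (2 * α) := by
  have hα0 : α ≠ 0 := fun h => by simp [h] at hα
  set δ := min 1 (α.re / 2) with hδ
  have hδ0 : 0 < δ := lt_min one_pos (by linarith)
  have hδ1 : δ ≤ 1 := min_le_left _ _
  have hδα : 2 * δ ≤ α.re := by linarith [min_le_right 1 (α.re / 2)]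
  set C := (a ^ 2) ^ (-δ) / δ with hC
  have hC0 : 0 ≤ C := by positivity
  obtain ⟨hi, hI⟩ := integrableOn_and_integral_inv_mul_exp_mul_cpow hα ha hy
  set u : ℝ → ℂ := fun x => (expIntegralE1 (a ^ 2 / x ^ 2) : ℂ) with hu
  set v : ℝ → ℂ := fun x => ((x ^ 2 + y ^ 2 : ℝ) : ℂ) ^ (-α) / (-2 * α) with hv
  have hnorm : ∀ x : ℝ, 0 < x → ∀ B : ℝ, ‖((x ^ 2 + y ^ 2 : ℝ) : ℂ) ^ (-α)‖ ≤ B →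
      ‖(u * v) x‖ ≤ C * x ^ (2 * δ) * (B / ‖-2 * α‖) := by
    intro x hx B hB
    rw [Pi.mul_apply, hu, hv, norm_mul, norm_div, Complex.norm_real,
      Real.norm_of_nonneg (expIntegralE1_nonneg (by positivity))]
    have := expIntegralE1_div_sq_le ha hx hδ0 hδ1
    gcongr
  have huv : ∀ x : ℝ, ((2 / x * Real.exp (-(a ^ 2 / x ^ 2)) : ℝ) : ℂ) * v x =
      ((2 / x * Real.exp (-(a ^ 2 / x ^ 2)) : ℝ) : ℂ) *
        ((x ^ 2 + y ^ 2 : ℝ) : ℂ) ^ (-α) / (-2 * α) := fun x => by rw [hv]; ring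
  have hlim0 : Tendsto (u * v) (𝓝[>] 0) (𝓝 0) := by
    have h1 : Tendsto (fun x : ℝ => C * x ^ (2 * δ) * (y ^ (-2 * α.re) / ‖-2 * α‖)) (𝓝[>] 0)
        (𝓝 0) := by
      have h2 := (Real.continuousAt_rpow_const 0 (2 * δ) (Or.inr (by linarith))).tendsto
      rw [Real.zero_rpow (by linarith)] at h2
      simpa using ((h2.const_mul C).mul_const (y ^ (-2 * α.re) / ‖-2 * α‖)).mono_left
        (nhdsWithin_le_nhds (s := Ioi 0))
    refine squeeze_zero_norm' ?_ h1
    filter_upwards [self_mem_nhdsWithin] with x hx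
    exact hnorm x hx _ (norm_sq_add_sq_cpow_neg_le_right hα.le hy)
  have hliminf : Tendsto (u * v) atTop (𝓝 0) := by
    have h1 : Tendsto (fun x : ℝ => C / ‖-2 * α‖ * x ^ (-(2 * α.re - 2 * δ))) atTop (𝓝 0) := by
      simpa using (tendsto_rpow_neg_atTop (by linarith : 0 < 2 * α.re - 2 * δ)).const_mul
        (C / ‖-2 * α‖)
    refine squeeze_zero_norm' ?_ h1
    filter_upwards [eventually_gt_atTop 0] with x hx
    refine (hnorm x hx _ (norm_sq_add_sq_cpow_neg_le_left hα.le hx)).trans (le_of_eq ?_)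
    rw [show -(2 * α.re - 2 * δ) = 2 * δ + -2 * α.re by ring, Real.rpow_add hx]
    ring
  have key := integral_Ioi_mul_deriv_eq_deriv_mul (a := 0) (u := u) (v := v)
    (u' := fun x => ((2 / x * Real.exp (-(a ^ 2 / x ^ 2)) : ℝ) : ℂ))
    (v' := fun x => (x : ℂ) * ((x ^ 2 + y ^ 2 : ℝ) : ℂ) ^ (-(α + 1)))
    (fun x hx => (hasDerivAt_expIntegralE1_div_sq ha hx).ofReal_comp)
    (fun x _ => hasDerivAt_sq_add_sq_cpow hα0 hy x)
    (integrableOn_potentialIntegrand_expIntegralE1 hα ha hy)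
    ((integrableOn_congr_fun (fun x _ => huv x) measurableSet_Ioi).2 (hi.div_const _))
    hlim0 hliminf
  rw [key]
  simp_rw [huv]
  rw [integral_div, hI, sub_zero, zero_sub, neg_mul, div_neg, neg_neg]

end Transform

theorem mainTheorem9 (ν : ℂ) (hν : 1 < ν.re) (a y : ℝ) (ha : 0 < a) (hy : 0 < y) :
    IntegrableOn
        (potentialIntegrand ν (fun x : ℝ => (expIntegralE1 (a ^ 2 / x ^ 2) : ℂ)) y)
        (Ioi (0 : ℝ)) ∧
      potentialTransform ν (fun x : ℝ => (expIntegralE1 (a ^ 2 / x ^ 2) : ℂ)) y =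
        Complex.Gamma (ν - 1) / (2 * (a : ℂ) * (ν - 1)) * (y : ℂ) ^ (-2 * ν + 3) *
          Complex.exp ((a : ℂ) ^ 2 / (2 * (y : ℂ) ^ 2)) *
          whittakerW (-ν + 3 / 2) 0 (a ^ 2 / y ^ 2) := by
  obtain ⟨α, rfl⟩ : ∃ α : ℂ, ν = α + 1 := ⟨ν - 1, by ring⟩
  have hα : 0 < α.re := by simpa using hν
  have hint : potentialIntegrand (α + 1) (fun x : ℝ => (expIntegralE1 (a ^ 2 / x ^ 2) : ℂ)) y =
      fun x : ℝ => (expIntegralE1 (a ^ 2 / x ^ 2) : ℂ) *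
        ((x : ℂ) * ((x ^ 2 + y ^ 2 : ℝ) : ℂ) ^ (-(α + 1))) := by
    funext x
    rw [potentialIntegrand, Complex.cpow_neg]
    ring
  refine ⟨by rw [hint]; exact integrableOn_potentialIntegrand_expIntegralE1 hα ha hy, ?_⟩
  have hz : 0 < a ^ 2 / y ^ 2 := by positivity
  have ha0 : (a : ℂ) ≠ 0 := Complex.ofReal_ne_zero.2 ha.ne'
  have hy0 : (y : ℂ) ≠ 0 := Complex.ofReal_ne_zero.2 hy.ne'
  have hα0 : α ≠ 0 := fun h => by simp [h] at hα
  have hΓ : Complex.Gamma α ≠ 0 := Complex.Gamma_ne_zero_of_re_pos hα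
  have hsqrt : ((a ^ 2 / y ^ 2 : ℝ) : ℂ) ^ (1 / 2 : ℂ) = a / y := by
    have h0 : ((a / y : ℝ) : ℂ) ≠ 0 := Complex.ofReal_ne_zero.2 (by positivity)
    rw [show a ^ 2 / y ^ 2 = a / y * (a / y) by ring, Complex.ofReal_mul,
      Complex.mul_cpow_ofReal_nonneg (by positivity) (by positivity), ← Complex.cpow_add _ _ h0,
      add_halves, Complex.cpow_one, Complex.ofReal_div]
  have hyα : ((y ^ 2 : ℝ) : ℂ) ^ (-α) = (y : ℂ) ^ (-α) * (y : ℂ) ^ (-α) := by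
    rw [sq, Complex.ofReal_mul, Complex.mul_cpow_ofReal_nonneg hy.le hy.le]
  have hyν : (y : ℂ) ^ (-2 * (α + 1) + 3) = (y : ℂ) ^ (-α) * (y : ℂ) ^ (-α) * y := by
    rw [show -2 * (α + 1) + 3 = -α + -α + 1 by ring, Complex.cpow_add _ _ hy0,
      Complex.cpow_add _ _ hy0, Complex.cpow_one]
  have hexp : Complex.exp (-((a ^ 2 / y ^ 2 : ℝ) : ℂ) / 2) =
      (Complex.exp ((a : ℂ) ^ 2 / (2 * (y : ℂ) ^ 2)))⁻¹ := by
    rw [← Complex.exp_neg]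
    congr 1
    push_cast
    field_simp
  have hE := Complex.exp_ne_zero ((a : ℂ) ^ 2 / (2 * (y : ℂ) ^ 2))
  rw [potentialTransform, hint, integral_expIntegralE1_mul_cpow hα ha hy,
    show -(α + 1) + 3 / 2 = 1 / 2 - α by ring,
    (isWhittakerW_laplaceIntegral hα).whittakerW_eq hz, hsqrt, hyα, hyν, hexp,
    add_sub_cancel_right]
  field_simp
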